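/- Graphs are finite, simple, loop-free and undirected, and may be empty. For a graph $G=(V,E)$ let $\lceil G\rceil=\langle V\cup E,\mathrm{inc}\rangle$ be its incidence structure, where $V$ and $E$ are taken to be disjoint and $\mathrm{inc}\subseteq V\times E$ relates each vertex to the edges containing it. Let $\mathrm{Sep}(G,k)$ be the maximal number of connected components of $G-S$, where $S\subseteq V$ ranges over all sets of at most $k$ vertices. Let $\exp_0(k)=k$ and $\exp_{j+1}(k)=2^{\exp_j(k)}$; a function $f:\mathbb N\to\mathbb N$ is called elementary if there is a fixed $j$ with $f(k)\le\exp_j(k)$ for all $k$. The quantifier rank of a monadic second-order (MSO) formula is its maximal number of nested quantifiers, first-order and set quantifiers being both counted. An MSO-formula $\varphi(x,y;Z_0,\dots,Z_{n-1})$ over the signature $\{\mathrm{inc}\}$, with first-order variables $x,y$ and set variables $Z_i$, orders $\lceil G\rceil$ if there are sets (parameters) $P_0,\dots,P_{n-1}\subseteq V\cup E$ such that the relation defined by $\varphi(x,y;P_0,\dots,P_{n-1})$ in $\lceil G\rceil$ is a (reflexive) linear order on $V\cup E$. (1) There exists a function $f:\mathbb N^3\to\mathbb N$ such that, for all $n,m,k\in\mathbb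 N$ and every graph $G$ for which $\lceil G\rceil$ is ordered by some MSO-formula $\varphi(x,y;Z_0,\dots,Z_{n-1})$ of quantifier rank at most $m$, $$\mathrm{Sep}(G,k)\le f(n,m,k).$$ Furthermore, $f$ is effectively elementary in the argument $k$, that is, there exists a computable function $g:\mathbb N^2\to\mathbb N$ such that $f(n,m,k)\le\exp_{g(n,m)}(k)$ for all $n,m,k\in\mathbb N$. (2) Let $\mathcal C$ be a class of graphs that is $\mathrm{MSO}_2$-orderable, that is, there are $n\in\mathbb N$ and a single MSO-formula $\varphi(x,y;Z_0,\dots,Z_{n-1})$ that orders $\lceil G\rceil$ for every non-empty $G\in\mathcal C$. Then there is an elementary function $f:\mathbb N\to\mathbb N$ such that $\mathcal C$ has property $\mathsf{SEP}(f)$, i.e. $\mathrm{Sep}(G,k)\le f(k)$ for all $G\in\mathcal C$ and all $k\in\mathbb N$. -/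

import Mathlib

universe u v w

namespace MSOOrder

/-- Formulae of monadic second-order logic over a relational signature `L`
(function symbols of `L`, if any, are not used), with free first-order variables
indexed by `Fin p` and free set variables indexed by `Fin q`.
In `all φ` (resp. `allSet φ`) the quantified variable is the last first-order
(resp. set) variable of `φ`. The remaining connectives and the existential quantifiers
are the usual abbreviations; these do not affect the quantifier rank. -/
inductive Formula (L : FirstOrder.Language.{v, w}) : ℕ → ℕ → Type w
  | falsum {p q : ℕ} : Formula L p q
  | equal {p q : ℕ} (i j : Fin p) : Formula L p q
  | rel {p q r : ℕ} (R : L.Relations r) (i : Fin r → Fin p) : Formula L p q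
  | mem {p q : ℕ} (i : Fin p) (X : Fin q) : Formula L p q
  | imp {p q : ℕ} (φ ψ : Formula L p q) : Formula L p q
  | all {p q : ℕ} (φ : Formula L (p + 1) q) : Formula L p q
  | allSet {p q : ℕ} (φ : Formula L p (q + 1)) : Formula L p q

namespace Formula

variable {L : FirstOrder.Language.{v, w}}

/-- Quantifier rank: the maximal number of nested quantifiers, counting both
first-order and second-order quantifiers. -/
def qr : {p q : ℕ} → Formula L p q → ℕ
  | _, _, falsum => 0
  | _, _, equal _ _ => 0
  | _, _, rel _ _ => 0
  | _, _, mem _ _ => 0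
  | _, _, imp φ ψ => max φ.qr ψ.qr
  | _, _, all φ => φ.qr + 1
  | _, _, allSet φ => φ.qr + 1

/-- Satisfaction of an MSO-formula in a structure `A`, where `a` assigns elements to the
first-order variables and `P` assigns subsets of `A` to the set variables. -/
def Realize {A : Type u} [L.Structure A] :
    {p q : ℕ} → Formula L p q → (Fin p → A) → (Fin q → Set A) → Prop
  | _, _, falsum, _, _ => False
  | _, _, equal i j, a, _ => a i = a j
  | _, _, rel R i, a, _ => FirstOrder.Language.Structure.RelMap R (fun t => a (i t))
  | _, _, mem i X, a, P => a i ∈ P X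
  | _, _, imp φ ψ, a, P => φ.Realize a P → ψ.Realize a P
  | _, _, all φ, a, P => ∀ b : A, φ.Realize (Fin.snoc (α := fun _ => A) a b) P
  | _, _, allSet φ, a, P => ∀ Q : Set A, φ.Realize a (Fin.snoc (α := fun _ => Set A) P Q)

/-- The structure `A` can be ordered by `φ(x, y; P₀, …, Pₙ₋₁)` for some choice of parameters
`P₀, …, Pₙ₋₁ ⊆ A`: the relation defined by this formula is a (reflexive) linear order on `A`. -/
def Orders {n : ℕ} (φ : Formula L 2 n) (A : Type u) [L.Structure A] : Prop :=
  ∃ P : Fin n → Set A, IsLinearOrder A (fun a b => φ.Realize ![a, b] P)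

end Formula

/-- The only symbol of the signature of incidence structures: the binary relation `inc`. -/
inductive IncRel : ℕ → Type
  | inc : IncRel 2

/-- The signature `{inc}`. -/
def incLang : FirstOrder.Language.{0, 0} := ⟨fun _ => Empty, IncRel⟩

/-- The universe `V ∪ E` (disjoint union) of the incidence structure `⌈G⌉` of a graph `G`. -/
abbrev Incidence {V : Type u} (G : SimpleGraph V) : Type u := V ⊕ G.edgeSet

/-- The incidence structure `⌈G⌉ = ⟨V ∪ E, inc⟩`, where `inc ⊆ V × E` relates a vertex to the
edges it belongs to. -/
instance incidenceStructure {V : Type u} (G : SimpleGraph V) :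
    incLang.Structure (Incidence G) where
  funMap := fun f _ => nomatch f
  RelMap := fun {_} R => match R with
    | IncRel.inc => fun x =>
        ∃ (v : V) (e : G.edgeSet), x 0 = Sum.inl v ∧ x 1 = Sum.inr e ∧ v ∈ (e : Sym2 V)

/-- `Sep(G, k)`: the maximal number of connected components of `G - S`, where `S` ranges over
all sets of at most `k` vertices. -/
noncomputable def sep {V : Type u} [Fintype V] (G : SimpleGraph V) (k : ℕ) : ℕ :=
  (Finset.univ.filter fun S : Finset V => S.card ≤ k).sup
    fun S => Nat.card (G.induce ((S : Set V)ᶜ)).ConnectedComponent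

/-- Finite (simple, loop-free, undirected) graphs, possibly empty. -/
structure FinGraph : Type (u + 1) where
  V : Type u
  [fintype : Fintype V]
  graph : SimpleGraph V

attribute [instance] FinGraph.fintype

/-- The class `C` of graphs is MSO₂-orderable: a single MSO-formula `φ(x, y; Z₀, …, Zₙ₋₁)` orders
every non-empty incidence structure `⌈G⌉` with `G ∈ C`. -/
def MSO2Orderable (C : Set FinGraph.{u}) : Prop :=
  ∃ (n : ℕ) (φ : Formula incLang 2 n),
    ∀ G ∈ C, Nonempty (Incidence G.graph) → φ.Orders (Incidence G.graph)

/-- The class `C` has property `SEP(f)`. -/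
def HasSEP (C : Set FinGraph.{u}) (f : ℕ → ℕ) : Prop :=
  ∀ G ∈ C, ∀ k : ℕ, sep G.graph k ≤ f k

/-- The iterated exponential: `exp₀(n) = n` and `exp_{j+1}(n) = 2 ^ exp_j(n)`. -/
def iterExp : ℕ → ℕ → ℕ
  | 0, n => n
  | j + 1, n => 2 ^ iterExp j n

/-- A function is elementary if it is bounded from above by some fixed `exp_j`. -/
def IsElementary (f : ℕ → ℕ) : Prop :=
  ∃ j : ℕ, ∀ k : ℕ, f k ≤ iterExp j k

end MSOOrder

namespace MSOOrder

open Set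

/-! ### Types of pieces of a structure -/

/-! This is an Ehrenfeucht–Fraïssé argument. Fix an ordering formula of quantifier rank at most `m`
with its parameters, and a set `S` of at most `k` vertices. Each component of `G - S`, with its
incident edges, is a piece attached to the rest only through `S`. Choose a vertex in every component
and record its rank-`m` type in its piece, once in the place of `x` and once in that of `y`. If two
components share both records, the chosen vertices can be exchanged in the formula
(`Swapped.realize`, `realize_swap`), so they compare both ways, against antisymmetry. Hence there
are at most as many components as pairs of types (`natCard_component_le`). Types form an iterated
power set in which `S` enters only at the bottom, so their number is a tower in `k` of height
depending only on `n` and `m` (`natCard_pieceType`). -/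

/-- The types of rank `j` of `r`-tuples of sets, with constants indexed by `κ`. -/
def PieceType (κ : Type u) : ℕ → ℕ → Type u
  | 0, r => Set ((Fin r ⊕ Fin r × Fin r) ⊕ (Fin r × Fin r ⊕ κ × Fin r))
  | j + 1, r => Set (PieceType κ j (r + 1))

theorem finite_pieceType (κ : Type u) [Finite κ] : ∀ j r, Finite (PieceType κ j r)
  | 0, r => inferInstanceAs
      (Finite (Set ((Fin r ⊕ Fin r × Fin r) ⊕ (Fin r × Fin r ⊕ κ × Fin r))))
  | j + 1, r =>
      haveI := finite_pieceType κ j (r + 1)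
      inferInstanceAs (Finite (Set (PieceType κ j (r + 1))))

instance (κ : Type u) [Finite κ] (j r : ℕ) : Finite (PieceType κ j r) := finite_pieceType κ j r

theorem natCard_set (α : Type u) [Finite α] : Nat.card (Set α) = 2 ^ Nat.card α := by
  classical
  have := Fintype.ofFinite α
  rw [Nat.card_eq_fintype_card, Nat.card_eq_fintype_card, Fintype.card_set]

/-- Each rank is one power set and lengthens the tuple by one, so `r + j` is invariant and fixes the
quadratic exponent at rank zero. -/
theorem natCard_pieceType (κ : Type u) [Finite κ] (j r : ℕ) :
    Nat.card (PieceType κ j r) =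
      iterExp (j + 1) ((r + j) * (1 + 2 * (r + j) + Nat.card κ)) := by
  induction j generalizing r with
  | zero =>
    refine (natCard_set _).trans ?_
    simp only [Nat.card_sum, Nat.card_prod, Nat.card_fin, iterExp]
    congr 1
    ring
  | succ j ih =>
    refine (natCard_set _).trans ?_
    rw [ih, show r + 1 + j = r + (j + 1) by ring]
    rfl

section Pieces

variable {A : Type u} {κ : Type u} (I : A → A → Prop) (c : κ → A)

/-- The properties of the tuple `X` of sets restricted to the piece `D` of the structure `(A, I)`
that can be observed without adding further sets. -/
def atomicType (D : Set A) {r : ℕ} (X : Fin r → Set A) :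
    Set ((Fin r ⊕ Fin r × Fin r) ⊕ (Fin r × Fin r ⊕ κ × Fin r)) :=
  {t | match t with
    | .inl (.inl i) => (X i ∩ D).Subsingleton
    | .inl (.inr (i, j)) => ∃ x ∈ D, x ∈ X i ∧ x ∈ X j
    | .inr (.inl (i, j)) => ∃ x ∈ D, ∃ y ∈ D, x ∈ X i ∧ y ∈ X j ∧ I x y
    | .inr (.inr (s, j)) => ∃ y ∈ D, y ∈ X j ∧ I (c s) y}

/-- The type of rank `j` of the tuple `X` of sets restricted to the piece `D` of the structure
`(A, I)`, where `c` lists constants that need not belong to `D`. In positive rank it collects the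
types of the extensions of `X` by one set. -/
def pieceType (D : Set A) : (j : ℕ) → {r : ℕ} → (Fin r → Set A) → PieceType κ j r
  | 0, _, X => atomicType I c D X
  | j + 1, r, X => Set.range fun Y : Set A =>
      pieceType D j (Fin.snoc (α := fun _ : Fin (r + 1) => Set A) X Y)

variable {I c}

theorem pieceType_congr {D : Set A} {j r : ℕ} {X X' : Fin r → Set A}
    (h : ∀ i, ∀ x ∈ D, x ∈ X i ↔ x ∈ X' i) : pieceType I c D j X = pieceType I c D j X' := by
  induction j generalizing r with
  | zero =>
    have hs : ∀ i, X i ∩ D = X' i ∩ D := fun i => by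
      ext x
      exact and_congr_left fun hx => h i x hx
    change atomicType I c D X = atomicType I c D X'
    ext t
    rcases t with (i | ⟨i, j⟩) | (⟨i, j⟩ | ⟨s, j⟩)
    · simp only [atomicType, mem_ofPred_eq, hs]
    · simp only [atomicType, mem_ofPred_eq]
      grind
    · simp only [atomicType, mem_ofPred_eq]
      grind
    · simp only [atomicType, mem_ofPred_eq]
      grind
  | succ j ih =>
    refine congrArg Set.range (funext fun Y => ih fun i => ?_)
    induction i using Fin.lastCases with
    | last => simp
    | cast i => simpa using h i

variable (I c)

/-- `D₁` and `D₂` are disjoint pieces of the structure `(A, I)` that are connected with the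
remaining elements through the constants `c` only. -/
structure ArePieces (D₁ D₂ : Set A) : Prop where
  disj : ∀ x ∈ D₁, x ∉ D₂
  const_left : ∀ s, c s ∉ D₁
  const_right : ∀ s, c s ∉ D₂
  out_left : ∀ x y, I x y → x ∈ D₁ → y ∈ D₁
  out_right : ∀ x y, I x y → x ∈ D₂ → y ∈ D₂
  in_left : ∀ x y, I x y → y ∈ D₁ → x ∈ D₁ ∨ x ∈ range c
  in_right : ∀ x y, I x y → y ∈ D₂ → x ∈ D₂ ∨ x ∈ range c

/-- The tuples `X` and `X'` agree outside `D₁ ∪ D₂`, and the types of rank `j` of `X` in `D₁` and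
`D₂` are those of `X'` in `D₂` and `D₁`. -/
structure Swapped (D₁ D₂ : Set A) (j : ℕ) {r : ℕ} (X X' : Fin r → Set A) : Prop where
  rest : ∀ i, ∀ x, x ∉ D₁ → x ∉ D₂ → (x ∈ X i ↔ x ∈ X' i)
  left : pieceType I c D₁ j X = pieceType I c D₂ j X'
  right : pieceType I c D₂ j X = pieceType I c D₁ j X'

variable {I c} {D₁ D₂ : Set A}

theorem Swapped.symm {j r : ℕ} {X X' : Fin r → Set A} (h : Swapped I c D₁ D₂ j X X') :
    Swapped I c D₁ D₂ j X' X :=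
  ⟨fun i x h₁ h₂ => (h.rest i x h₁ h₂).symm, h.right.symm, h.left.symm⟩

/-- One round of the game: the answer is assembled regionwise, from what the types supply on each
piece and from `Y` itself elsewhere. -/
theorem Swapped.forth (hD : ArePieces I c D₁ D₂) {j r : ℕ} {X X' : Fin r → Set A}
    (h : Swapped I c D₁ D₂ (j + 1) X X') (Y : Set A) :
    ∃ Y', Swapped I c D₁ D₂ j (Fin.snoc (α := fun _ : Fin (r + 1) => Set A) X Y)
      (Fin.snoc (α := fun _ : Fin (r + 1) => Set A) X' Y') := by
  obtain ⟨Y₂, h₂⟩ : pieceType I c D₁ j (Fin.snoc (α := fun _ : Fin (r + 1) => Set A) X Y) ∈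
      Set.range fun Y : Set A => pieceType I c D₂ j
        (Fin.snoc (α := fun _ : Fin (r + 1) => Set A) X' Y) := by
    have := h.left
    simp only [pieceType] at this
    rw [← this]
    exact ⟨Y, rfl⟩
  obtain ⟨Y₁, h₁⟩ : pieceType I c D₂ j (Fin.snoc (α := fun _ : Fin (r + 1) => Set A) X Y) ∈
      Set.range fun Y : Set A => pieceType I c D₁ j
        (Fin.snoc (α := fun _ : Fin (r + 1) => Set A) X' Y) := by
    have := h.right
    simp only [pieceType] at this
    rw [← this]
    exact ⟨Y, rfl⟩
  refine ⟨{x | (x ∈ D₁ ∧ x ∈ Y₁) ∨ (x ∈ D₂ ∧ x ∈ Y₂) ∨ (x ∉ D₁ ∧ x ∉ D₂ ∧ x ∈ Y)}, ?_, ?_, ?_⟩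
  · intro i
    induction i using Fin.lastCases with
    | last =>
      intro x hx₁ hx₂
      simp [hx₁, hx₂]
    | cast i => simpa using h.rest i
  · rw [← h₂]
    refine pieceType_congr fun i => ?_
    induction i using Fin.lastCases with
    | last =>
      intro x hx
      have : x ∉ D₁ := fun h => hD.disj x h hx
      simp [hx, this]
    | cast i => simp
  · rw [← h₁]
    refine pieceType_congr fun i => ?_
    induction i using Fin.lastCases with
    | last =>
      intro x hx
      simp [hx, hD.disj x hx]
    | cast i => simp

/-- Play empty sets until the rank is used up, then forget the added sets. -/
theorem Swapped.zero (hD : ArePieces I c D₁ D₂) {j r : ℕ} {X X' : Fin r → Set A}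
    (h : Swapped I c D₁ D₂ j X X') : Swapped I c D₁ D₂ 0 X X' := by
  induction j generalizing r with
  | zero => exact h
  | succ j ih =>
    obtain ⟨Y', hY⟩ := h.forth hD ∅
    have hY := ih hY
    have key : ∀ {D D' : Set A} {Y Y' : Set A},
        pieceType I c D 0 (Fin.snoc (α := fun _ : Fin (r + 1) => Set A) X Y) =
          pieceType I c D' 0 (Fin.snoc (α := fun _ : Fin (r + 1) => Set A) X' Y') →
        pieceType I c D 0 X = pieceType I c D' 0 X' := by
      intro D D' Y Y' h
      have h := Set.ext_iff.1 (show atomicType I c D _ = atomicType I c D' _ from h)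
      change atomicType I c D X = atomicType I c D' X'
      ext t
      rcases t with (i | ⟨i, j⟩) | (⟨i, j⟩ | ⟨s, j⟩)
      · simpa [atomicType] using h (.inl (.inl i.castSucc))
      · simpa [atomicType] using h (.inl (.inr (i.castSucc, j.castSucc)))
      · simpa [atomicType] using h (.inr (.inl (i.castSucc, j.castSucc)))
      · simpa [atomicType] using h (.inr (.inr (s, j.castSucc)))
    exact ⟨h.rest, key hY.left, key hY.right⟩

/-! ### Transfer of atomic facts at rank zero -/

section Atomic

variable {D D' : Set A} {r : ℕ} {X X' : Fin r → Set A}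

theorem subsingleton_iff_of_pieceType_eq (h : pieceType I c D 0 X = pieceType I c D' 0 X')
    (i : Fin r) : (X i ∩ D).Subsingleton ↔ (X' i ∩ D').Subsingleton :=
  Set.ext_iff.1 h (.inl (.inl i))

theorem exists_common_iff_of_pieceType_eq (h : pieceType I c D 0 X = pieceType I c D' 0 X')
    (i j : Fin r) : (∃ x ∈ D, x ∈ X i ∧ x ∈ X j) ↔ ∃ x ∈ D', x ∈ X' i ∧ x ∈ X' j :=
  Set.ext_iff.1 h (.inl (.inr (i, j)))

theorem exists_rel_iff_of_pieceType_eq (h : pieceType I c D 0 X = pieceType I c D' 0 X')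
    (i j : Fin r) : (∃ x ∈ D, ∃ y ∈ D, x ∈ X i ∧ y ∈ X j ∧ I x y) ↔
      ∃ x ∈ D', ∃ y ∈ D', x ∈ X' i ∧ y ∈ X' j ∧ I x y :=
  Set.ext_iff.1 h (.inr (.inl (i, j)))

theorem exists_const_rel_iff_of_pieceType_eq (h : pieceType I c D 0 X = pieceType I c D' 0 X')
    (s : κ) (j : Fin r) : (∃ y ∈ D, y ∈ X j ∧ I (c s) y) ↔ ∃ y ∈ D', y ∈ X' j ∧ I (c s) y :=
  Set.ext_iff.1 h (.inr (.inr (s, j)))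

theorem Swapped.exists_common (h : Swapped I c D₁ D₂ 0 X X') {i j : Fin r} {x : A}
    (hi : x ∈ X i) (hj : x ∈ X j) : ∃ x, x ∈ X' i ∧ x ∈ X' j := by
  by_cases h₁ : x ∈ D₁
  · obtain ⟨y, -, hy⟩ := (exists_common_iff_of_pieceType_eq h.left i j).1 ⟨x, h₁, hi, hj⟩
    exact ⟨y, hy⟩
  by_cases h₂ : x ∈ D₂
  · obtain ⟨y, -, hy⟩ := (exists_common_iff_of_pieceType_eq h.right i j).1 ⟨x, h₂, hi, hj⟩
    exact ⟨y, hy⟩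
  exact ⟨x, (h.rest i x h₁ h₂).1 hi, (h.rest j x h₁ h₂).1 hj⟩

/-- Split on the target `y`. A source of an arrow into a piece lies in that piece or is a constant,
and constants lie where both tuples agree; an arrow into the remainder starts there too. -/
theorem Swapped.exists_rel (hD : ArePieces I c D₁ D₂) (h : Swapped I c D₁ D₂ 0 X X')
    {i j : Fin r} {x y : A} (hi : x ∈ X i) (hj : y ∈ X j) (hI : I x y) :
    ∃ x ∈ X' i, ∃ y ∈ X' j, I x y := by
  by_cases h₁ : y ∈ D₁
  · rcases hD.in_left x y hI h₁ with hx | ⟨s, rfl⟩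
    · obtain ⟨a, -, b, -, ha, hb, hab⟩ :=
        (exists_rel_iff_of_pieceType_eq h.left i j).1 ⟨x, hx, y, h₁, hi, hj, hI⟩
      exact ⟨a, ha, b, hb, hab⟩
    · obtain ⟨b, -, hb, hab⟩ :=
        (exists_const_rel_iff_of_pieceType_eq h.left s j).1 ⟨y, h₁, hj, hI⟩
      exact ⟨_, (h.rest i _ (hD.const_left s) (hD.const_right s)).1 hi, b, hb, hab⟩
  by_cases h₂ : y ∈ D₂
  · rcases hD.in_right x y hI h₂ with hx | ⟨s, rfl⟩
    · obtain ⟨a, -, b, -, ha, hb, hab⟩ :=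
        (exists_rel_iff_of_pieceType_eq h.right i j).1 ⟨x, hx, y, h₂, hi, hj, hI⟩
      exact ⟨a, ha, b, hb, hab⟩
    · obtain ⟨b, -, hb, hab⟩ :=
        (exists_const_rel_iff_of_pieceType_eq h.right s j).1 ⟨y, h₂, hj, hI⟩
      exact ⟨_, (h.rest i _ (hD.const_left s) (hD.const_right s)).1 hi, b, hb, hab⟩
  exact ⟨x, (h.rest i x (fun hx => h₁ (hD.out_left x y hI hx))
    fun hx => h₂ (hD.out_right x y hI hx)).1 hi, y, (h.rest j y h₁ h₂).1 hj, hI⟩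

theorem Swapped.exists_eq_singleton (hD : ArePieces I c D₁ D₂) (h : Swapped I c D₁ D₂ 0 X X')
    {i : Fin r} {a : A} (ha : X i = {a}) : ∃ a', X' i = {a'} := by
  obtain ⟨b, hb, -⟩ := h.exists_common (i := i) (j := i) (x := a) (by simp [ha]) (by simp [ha])
  refine ⟨b, Set.Subset.antisymm (fun d hd => ?_) (by simpa using hb)⟩
  have hl := (subsingleton_iff_of_pieceType_eq h.left i).1
    ((Set.subsingleton_singleton (a := a)).anti (by simp [ha]))
  have hr := (subsingleton_iff_of_pieceType_eq h.right i).1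
    ((Set.subsingleton_singleton (a := a)).anti (by simp [ha]))
  -- Every point of `X' i` reveals the region of `a`, so all its points lie in one region, where
  -- there is at most one.
  have side : ∀ x ∈ X' i, (x ∈ D₁ ∧ a ∈ D₂) ∨ (x ∈ D₂ ∧ a ∈ D₁) ∨
      (x = a ∧ a ∉ D₁ ∧ a ∉ D₂) := by
    intro x hx
    by_cases h₁ : x ∈ D₁
    · obtain ⟨y, hy, hya, -⟩ := (exists_common_iff_of_pieceType_eq h.right i i).2 ⟨x, h₁, hx, hx⟩
      rw [ha] at hya
      exact .inl ⟨h₁, hya ▸ hy⟩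
    by_cases h₂ : x ∈ D₂
    · obtain ⟨y, hy, hya, -⟩ := (exists_common_iff_of_pieceType_eq h.left i i).2 ⟨x, h₂, hx, hx⟩
      rw [ha] at hya
      exact .inr (.inl ⟨h₂, hya ▸ hy⟩)
    have hxa := (h.rest i x h₁ h₂).2 hx
    rw [ha] at hxa
    exact .inr (.inr ⟨hxa, hxa ▸ h₁, hxa ▸ h₂⟩)
  rcases side b hb with ⟨hb₁, ha₂⟩ | ⟨hb₂, ha₁⟩ | ⟨rfl, ha₁, ha₂⟩ <;>
    rcases side d hd with ⟨hd₁, ha₂'⟩ | ⟨hd₂, ha₁'⟩ | ⟨rfl, ha₁', ha₂'⟩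
  · exact hr ⟨hd, hd₁⟩ ⟨hb, hb₁⟩
  · exact (hD.disj a ha₁' ha₂).elim
  · exact (ha₂' ha₂).elim
  · exact (hD.disj a ha₁ ha₂').elim
  · exact hl ⟨hd, hd₂⟩ ⟨hb, hb₂⟩
  · exact (ha₁' ha₁).elim
  · exact (ha₂ ha₂').elim
  · exact (ha₁ ha₁').elim
  · rfl

end Atomic

end Pieces

/-! ### Formulae do not distinguish swapped tuples -/

section Realize

variable {A : Type u}

/-- The tuple `X` lists (at the positions `s` and `t`) the singletons of `a` and the sets `P`. -/
structure Encodes {p q r : ℕ} (s : Fin p → Fin r) (t : Fin q → Fin r) (X : Fin r → Set A)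
    (a : Fin p → A) (P : Fin q → Set A) : Prop where
  elem : ∀ i, X (s i) = {a i}
  set : ∀ i, X (t i) = P i

theorem Encodes.snoc_elem {p q r : ℕ} {s : Fin p → Fin r} {t : Fin q → Fin r} {X : Fin r → Set A}
    {a : Fin p → A} {P : Fin q → Set A} (h : Encodes s t X a P) (b : A) :
    Encodes (Fin.snoc (α := fun _ => Fin (r + 1)) (fun i => (s i).castSucc) (Fin.last r))
      (fun i => (t i).castSucc) (Fin.snoc (α := fun _ : Fin (r + 1) => Set A) X {b})
      (Fin.snoc (α := fun _ => A) a b) P := by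
  refine ⟨fun i => ?_, fun i => by simpa using h.set i⟩
  induction i using Fin.lastCases with
  | last => simp
  | cast i => simpa using h.elem i

theorem Encodes.snoc_set {p q r : ℕ} {s : Fin p → Fin r} {t : Fin q → Fin r} {X : Fin r → Set A}
    {a : Fin p → A} {P : Fin q → Set A} (h : Encodes s t X a P) (Q : Set A) :
    Encodes (fun i => (s i).castSucc)
      (Fin.snoc (α := fun _ => Fin (r + 1)) (fun i => (t i).castSucc) (Fin.last r))
      (Fin.snoc (α := fun _ : Fin (r + 1) => Set A) X Q)
      a (Fin.snoc (α := fun _ => Set A) P Q) := by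
  refine ⟨fun i => by simpa using h.elem i, fun i => ?_⟩
  induction i using Fin.lastCases with
  | last => simp
  | cast i => simpa using h.set i

/-- The parameters `P` followed by the sets `Y` and `Z`. -/
def paramsWith {n : ℕ} (P : Fin n → Set A) (Y Z : Set A) : Fin (n + 1 + 1) → Set A :=
  Fin.snoc (α := fun _ => Set A) (Fin.snoc (α := fun _ => Set A) P Y) Z

theorem encodes_paramsWith {n : ℕ} (P : Fin n → Set A) (x y : A) :
    Encodes ![(Fin.last n).castSucc, Fin.last (n + 1)] (fun i => i.castSucc.castSucc)
      (paramsWith P {x} {y}) ![x, y] P := by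
  refine ⟨fun i => ?_, fun i => ?_⟩
  · fin_cases i <;> simp [paramsWith]
  · simp [paramsWith]

theorem paramsWith_congr {κ : Type u} {c : κ → A} {n j : ℕ} {I : A → A → Prop}
    (P : Fin n → Set A) {Y Z Y' Z' D : Set A}
    (hY : ∀ x ∈ D, x ∈ Y ↔ x ∈ Y') (hZ : ∀ x ∈ D, x ∈ Z ↔ x ∈ Z') :
    pieceType I c D j (paramsWith P Y Z) = pieceType I c D j (paramsWith P Y' Z') := by
  refine pieceType_congr fun i => ?_
  induction i using Fin.lastCases with
  | last => simpa [paramsWith] using hZ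
  | cast i =>
    induction i using Fin.lastCases with
    | last => simpa [paramsWith] using hY
    | cast i => simp [paramsWith]

variable [incLang.Structure A] {κ : Type u} {c : κ → A} {D₁ D₂ : Set A}

/-- The binary relation interpreting `inc` in a structure. -/
def incRel (x y : A) : Prop :=
  FirstOrder.Language.Structure.RelMap (L := incLang) (M := A) (IncRel.inc : incLang.Relations 2)
    ![x, y]

/-- Elements are played as singletons, so both kinds of quantifiers use the same set move. -/
theorem Swapped.realize (hD : ArePieces incRel c D₁ D₂) {p q : ℕ} (φ : Formula incLang p q) :
    ∀ {j r : ℕ} {X X' : Fin r → Set A} {s : Fin p → Fin r} {t : Fin q → Fin r} {a a' : Fin p → A}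
      {P P' : Fin q → Set A}, φ.qr ≤ j → Swapped incRel c D₁ D₂ j X X' →
      Encodes s t X a P → Encodes s t X' a' P' → φ.Realize a P → φ.Realize a' P' := by
  induction φ with
  | falsum => exact fun _ _ _ _ h => h
  | equal i k =>
    intro j r X X' s t a a' P P' _ hX h h' hr
    obtain ⟨x, hi, hk⟩ := (hX.zero hD).exists_common (i := s i) (j := s k) (x := a i)
      (by simp [h.elem]) (by rw [h.elem]; exact hr)
    rw [h'.elem] at hi hk
    exact hi.symm.trans hk
  | rel R i =>
    intro j r X X' s t a a' P P' _ hX h h' hr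
    cases R
    have e : ∀ b : Fin 2 → A, b = ![b 0, b 1] := fun b => by
      ext l
      fin_cases l <;> rfl
    simp only [Formula.Realize] at hr ⊢
    rw [e fun l => a (i l)] at hr
    rw [e fun l => a' (i l)]
    obtain ⟨x, hx, y, hy, hxy⟩ := (hX.zero hD).exists_rel hD (i := s (i 0)) (j := s (i 1))
      (x := a (i 0)) (y := a (i 1)) (by simp [h.elem]) (by simp [h.elem]) hr
    rw [h'.elem] at hx hy
    rw [mem_singleton_iff] at hx hy
    subst hx hy
    exact hxy
  | mem i k =>
    intro j r X X' s t a a' P P' _ hX h h' hr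
    obtain ⟨x, hi, hk⟩ := (hX.zero hD).exists_common (i := s i) (j := t k) (x := a i)
      (by simp [h.elem]) (by rw [h.set]; exact hr)
    rw [h'.elem] at hi
    rw [h'.set] at hk
    rw [mem_singleton_iff] at hi
    subst hi
    exact hk
  | imp φ ψ hφ hψ =>
    intro j r X X' s t a a' P P' hj hX h h' hr h1
    simp only [Formula.qr, max_le_iff] at hj
    exact hψ hj.2 hX h h' (hr (hφ hj.1 hX.symm h' h h1))
  | all φ hφ =>
    intro j r X X' s t a a' P P' hj hX h h' hr b'
    obtain _ | j := j
    · simp [Formula.qr] at hj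
    obtain ⟨Y, hY⟩ := hX.symm.forth hD {b'}
    -- The answer to a singleton is a singleton, because rank-zero types detect this; so it names an
    -- element.
    obtain ⟨b, hb⟩ := (hY.zero hD).exists_eq_singleton hD (i := Fin.last r) (a := b') (by simp)
    rw [Fin.snoc_last] at hb
    subst hb
    exact hφ (Nat.le_of_succ_le_succ hj) hY.symm (h.snoc_elem b) (h'.snoc_elem b') (hr b)
  | allSet φ hφ =>
    intro j r X X' s t a a' P P' hj hX h h' hr Q'
    obtain _ | j := j
    · simp [Formula.qr] at hj
    obtain ⟨Q, hQ⟩ := hX.symm.forth hD Q'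
    exact hφ (Nat.le_of_succ_le_succ hj) hQ.symm (h.snoc_set Q) (h'.snoc_set Q') (hr Q)

/-- Elements of two pieces that have the same type can be exchanged in a formula. -/
theorem realize_swap (hD : ArePieces incRel c D₁ D₂) {n m : ℕ} {φ : Formula incLang 2 n}
    (hφ : φ.qr ≤ m) (P : Fin n → Set A) {x₁ x₂ : A} (h₁ : x₁ ∈ D₁) (h₂ : x₂ ∈ D₂)
    (hl : pieceType incRel c D₁ m (paramsWith P {x₁} ∅) =
      pieceType incRel c D₂ m (paramsWith P {x₂} ∅))
    (hr : pieceType incRel c D₁ m (paramsWith P ∅ {x₁}) =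
      pieceType incRel c D₂ m (paramsWith P ∅ {x₂}))
    (h : φ.Realize ![x₁, x₂] P) : φ.Realize ![x₂, x₁] P := by
  have hx₁ : ∀ x ∈ D₂, x ∈ ({x₁} : Set A) ↔ x ∈ (∅ : Set A) := by
    rintro x hx
    simpa using fun e : x = x₁ => hD.disj x₁ h₁ (e ▸ hx)
  have hx₂ : ∀ x ∈ D₁, x ∈ ({x₂} : Set A) ↔ x ∈ (∅ : Set A) := by
    rintro x hx
    simpa using fun e : x = x₂ => hD.disj x₂ (e ▸ hx) h₂
  -- Only `x₁` and `x₂` trade places; the parameters stay. Inside one piece the point of the other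
  -- is invisible, so its singleton may be replaced by `∅`.
  refine Swapped.realize hD φ hφ ⟨fun i x hx₁ hx₂ => ?_, ?_, ?_⟩
    (encodes_paramsWith P x₁ x₂) (encodes_paramsWith P x₂ x₁) h
  · have e₁ : x ≠ x₁ := fun e => hx₁ (e ▸ h₁)
    have e₂ : x ≠ x₂ := fun e => hx₂ (e ▸ h₂)
    induction i using Fin.lastCases with
    | last => simp [paramsWith, e₁, e₂]
    | cast i =>
      induction i using Fin.lastCases with
      | last => simp [paramsWith, e₁, e₂]
      | cast i => simp [paramsWith]
  · exact (paramsWith_congr P (fun _ _ => Iff.rfl) hx₂).trans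
      (hl.trans (paramsWith_congr P (fun _ _ => Iff.rfl) fun x hx => (hx₁ x hx).symm))
  · exact (paramsWith_congr P hx₁ fun _ _ => Iff.rfl).trans
      (hr.symm.trans (paramsWith_congr P (fun x hx => (hx₂ x hx).symm) fun _ _ => Iff.rfl))

end Realize

/-! ### Components of a graph minus a set of vertices -/

section Components

variable {V : Type u} (G : SimpleGraph V) (S : Finset V)

/-- The vertices of a component of `G - S` together with the edges incident with them. -/
def componentPiece (C : (G.induce ((S : Set V)ᶜ)).ConnectedComponent) : Set (Incidence G) :=
  {z | ∃ (v : V) (hv : v ∈ (S : Set V)ᶜ),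
    (G.induce ((S : Set V)ᶜ)).connectedComponentMk ⟨v, hv⟩ = C ∧
      (z = .inl v ∨ ∃ e : G.edgeSet, z = .inr e ∧ v ∈ (e : Sym2 V))}

variable {G S}

theorem incRel_iff {x y : Incidence G} : incRel x y ↔
    ∃ (v : V) (e : G.edgeSet), x = .inl v ∧ y = .inr e ∧ v ∈ (e : Sym2 V) := Iff.rfl

theorem component_eq_of_mem_edge {e : G.edgeSet} {v w : V} (hv : v ∈ (S : Set V)ᶜ)
    (hw : w ∈ (S : Set V)ᶜ) (hve : v ∈ (e : Sym2 V)) (hwe : w ∈ (e : Sym2 V)) :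
    (G.induce ((S : Set V)ᶜ)).connectedComponentMk ⟨v, hv⟩ =
      (G.induce ((S : Set V)ᶜ)).connectedComponentMk ⟨w, hw⟩ := by
  by_cases hvw : v = w
  · subst hvw
    rfl
  have he : (e : Sym2 V) = s(v, w) := (Sym2.mem_and_mem_iff hvw).1 ⟨hve, hwe⟩
  have hadj : G.Adj v w := by
    rw [← SimpleGraph.mem_edgeSet, ← he]
    exact e.2
  exact SimpleGraph.ConnectedComponent.eq.2 (SimpleGraph.Adj.reachable hadj)

theorem inl_mem_componentPiece {C : (G.induce ((S : Set V)ᶜ)).ConnectedComponent} {v : V} :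
    .inl v ∈ componentPiece G S C ↔ ∃ hv : v ∈ (S : Set V)ᶜ,
      (G.induce ((S : Set V)ᶜ)).connectedComponentMk ⟨v, hv⟩ = C := by
  constructor
  · rintro ⟨w, hw, hC, h | ⟨e, h, -⟩⟩
    · cases h
      exact ⟨hw, hC⟩
    · cases h
  · rintro ⟨hv, hC⟩
    exact ⟨v, hv, hC, .inl rfl⟩

theorem inr_mem_componentPiece {C : (G.induce ((S : Set V)ᶜ)).ConnectedComponent}
    {e : G.edgeSet} : .inr e ∈ componentPiece G S C ↔ ∃ (v : V) (hv : v ∈ (S : Set V)ᶜ),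
      (G.induce ((S : Set V)ᶜ)).connectedComponentMk ⟨v, hv⟩ = C ∧ v ∈ (e : Sym2 V) := by
  constructor
  · rintro ⟨w, hw, hC, h | ⟨e, h, he⟩⟩
    · cases h
    · cases h
      exact ⟨w, hw, hC, he⟩
  · rintro ⟨v, hv, hC, he⟩
    exact ⟨v, hv, hC, .inr ⟨e, rfl, he⟩⟩

theorem componentPiece_disjoint {C C' : (G.induce ((S : Set V)ᶜ)).ConnectedComponent}
    (hC : C ≠ C') : ∀ x ∈ componentPiece G S C, x ∉ componentPiece G S C' := by
  rintro (v | e) hx hx'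
  · rw [inl_mem_componentPiece] at hx hx'
    obtain ⟨hv, h⟩ := hx
    obtain ⟨_, h'⟩ := hx'
    exact hC (h.symm.trans h')
  · rw [inr_mem_componentPiece] at hx hx'
    obtain ⟨v, hv, rfl, hve⟩ := hx
    obtain ⟨w, hw, rfl, hwe⟩ := hx'
    exact hC (component_eq_of_mem_edge hv hw hve hwe)

theorem inl_notMem_componentPiece (C : (G.induce ((S : Set V)ᶜ)).ConnectedComponent) (s : S) :
    (.inl (s : V) : Incidence G) ∉ componentPiece G S C := by
  rw [inl_mem_componentPiece]
  rintro ⟨h, -⟩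
  exact h s.2

theorem componentPiece_of_incRel (C : (G.induce ((S : Set V)ᶜ)).ConnectedComponent)
    (x y : Incidence G) (h : incRel x y) (hx : x ∈ componentPiece G S C) :
    y ∈ componentPiece G S C := by
  obtain ⟨v, e, rfl, rfl, hve⟩ := incRel_iff.1 h
  obtain ⟨hv, hC⟩ := inl_mem_componentPiece.1 hx
  exact inr_mem_componentPiece.2 ⟨v, hv, hC, hve⟩

theorem componentPiece_or_range_of_incRel (C : (G.induce ((S : Set V)ᶜ)).ConnectedComponent)
    (x y : Incidence G) (h : incRel x y) (hy : y ∈ componentPiece G S C) :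
    x ∈ componentPiece G S C ∨ x ∈ range fun s : S => (.inl (s : V) : Incidence G) := by
  obtain ⟨w, e, rfl, rfl, hwe⟩ := incRel_iff.1 h
  obtain ⟨v, hv, hC, hve⟩ := inr_mem_componentPiece.1 hy
  by_cases hw : w ∈ S
  · exact .inr ⟨⟨w, hw⟩, rfl⟩
  · exact .inl (inl_mem_componentPiece.2
      ⟨by simpa using hw, (component_eq_of_mem_edge _ hv hwe hve).trans hC⟩)

theorem arePieces_componentPiece {C C' : (G.induce ((S : Set V)ᶜ)).ConnectedComponent}
    (hC : C ≠ C') : ArePieces incRel (fun s : S => (.inl (s : V) : Incidence G))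
      (componentPiece G S C) (componentPiece G S C') where
  disj := componentPiece_disjoint hC
  const_left := inl_notMem_componentPiece C
  const_right := inl_notMem_componentPiece C'
  out_left := componentPiece_of_incRel C
  out_right := componentPiece_of_incRel C'
  in_left := componentPiece_or_range_of_incRel C
  in_right := componentPiece_or_range_of_incRel C'

/-- If `⌈G⌉` is ordered by a formula, then the components of `G - S` can be told apart by their
types. -/
theorem natCard_component_le {n m : ℕ} {φ : Formula incLang 2 n} (hφ : φ.qr ≤ m)
    (hO : φ.Orders (Incidence G)) :
    Nat.card (G.induce ((S : Set V)ᶜ)).ConnectedComponent ≤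
      Nat.card (PieceType S m (n + 2)) * Nat.card (PieceType S m (n + 2)) := by
  obtain ⟨P, hP⟩ := hO
  rw [← Nat.card_prod]
  let x : (G.induce ((S : Set V)ᶜ)).ConnectedComponent → Incidence G :=
    fun C => .inl (C.out : ↥((S : Set V)ᶜ)).1
  have hx : ∀ C, x C ∈ componentPiece G S C := fun C =>
    inl_mem_componentPiece.2 ⟨C.out.2, Quot.out_eq C⟩
  refine Nat.card_le_card_of_injective
    (fun C => (pieceType incRel (fun s : S => (.inl (s : V) : Incidence G)) (componentPiece G S C) m
        (paramsWith P {x C} ∅),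
      pieceType incRel (fun s : S => (.inl (s : V) : Incidence G)) (componentPiece G S C) m
        (paramsWith P ∅ {x C}))) fun C C' h => ?_
  by_contra hC
  rw [Prod.mk.injEq] at h
  have h₁ := realize_swap (arePieces_componentPiece hC) hφ P (hx C) (hx C') h.1 h.2
  have h₂ := realize_swap (arePieces_componentPiece (Ne.symm hC)) hφ P (hx C') (hx C)
    h.1.symm h.2.symm
  have hxx : x C = x C' := by
    rcases hP.total (x C) (x C') with h | h
    · exact hP.antisymm _ _ h (h₁ h)
    · exact hP.antisymm _ _ (h₂ h) h
  exact componentPiece_disjoint hC _ (hx C) (hxx ▸ hx C')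

end Components

/-! ### Bounds by iterated exponentials -/

theorem iterExp_mono (j : ℕ) : Monotone (iterExp j) := by
  induction j with
  | zero => exact monotone_id
  | succ j ih => exact fun a b h => Nat.pow_le_pow_right two_pos (ih h)

theorem iterExp_add (i j k : ℕ) : iterExp (i + j) k = iterExp i (iterExp j k) := by
  induction i with
  | zero => simp [iterExp]
  | succ i ih => rw [Nat.succ_add, iterExp, iterExp, ih]

theorem add_le_iterExp (j k : ℕ) : j + k ≤ iterExp j k := by
  induction j with
  | zero => simp [iterExp]
  | succ j ih =>
    have := Nat.lt_two_pow_self (n := iterExp j k)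
    rw [iterExp]
    omega

theorem mul_self_le_iterExp_two (x : ℕ) : x * x ≤ iterExp 2 x := by
  have h := Nat.lt_two_pow_self (n := x)
  calc x * x ≤ 2 ^ x * 2 ^ x := Nat.mul_le_mul h.le h.le
    _ = 2 ^ (x + x) := (pow_add 2 x x).symm
    _ ≤ 2 ^ 2 ^ x := Nat.pow_le_pow_right two_pos ?_
  cases x with
  | zero => simp
  | succ x =>
    have := Nat.lt_two_pow_self (n := x)
    rw [pow_succ]
    omega

/-- The height adds up as 2 for the square, `m + 1` for the power sets, 2 for the product at the
bottom and `1 + 2 * (n + 2 + m)` to absorb its additive constant. -/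
theorem sq_natCard_pieceType_le (κ : Type u) [Finite κ] {n m k : ℕ} (hk : Nat.card κ ≤ k) :
    Nat.card (PieceType κ m (n + 2)) * Nat.card (PieceType κ m (n + 2)) ≤
      iterExp (2 * n + 3 * m + 10) k := by
  refine (mul_self_le_iterExp_two _).trans ?_
  rw [natCard_pieceType, ← iterExp_add]
  have h : (n + 2 + m) * (1 + 2 * (n + 2 + m) + Nat.card κ) ≤
      iterExp (2 + (1 + 2 * (n + 2 + m))) k := by
    rw [iterExp_add]
    refine (Nat.mul_le_mul ?_ ?_).trans ((mul_self_le_iterExp_two _).trans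
      (iterExp_mono 2 (add_le_iterExp _ _))) <;> omega
  refine (iterExp_mono _ h).trans ?_
  rw [← iterExp_add]
  exact le_of_eq (congrArg (iterExp · k) (by ring))

theorem sep_le_iterExp {n m : ℕ} (k : ℕ) (G : FinGraph.{u}) {φ : Formula incLang 2 n}
    (hφ : φ.qr ≤ m) (hO : φ.Orders (Incidence G.graph)) :
    sep G.graph k ≤ iterExp (2 * n + 3 * m + 10) k := by
  refine Finset.sup_le fun S hS => (natCard_component_le hφ hO).trans ?_
  refine sq_natCard_pieceType_le S ?_
  simpa using (Finset.mem_filter.1 hS).2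

theorem computable_linear : Computable₂ fun n m : ℕ => 2 * n + 3 * m + 10 :=
  (Primrec.nat_add.comp
    (Primrec.nat_add.comp (Primrec.nat_mul.comp (Primrec.const 2) Primrec.fst)
      (Primrec.nat_mul.comp (Primrec.const 3) Primrec.snd)) (Primrec.const 10)).to_comp

end MSOOrder

theorem mainTheorem2 :
    (∃ f : ℕ → ℕ → ℕ → ℕ,
      (∀ (n m k : ℕ) (G : MSOOrder.FinGraph.{u}) (φ : MSOOrder.Formula MSOOrder.incLang 2 n),
        φ.qr ≤ m → φ.Orders (MSOOrder.Incidence G.graph) →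
          MSOOrder.sep G.graph k ≤ f n m k) ∧
      ∃ g : ℕ → ℕ → ℕ, Computable₂ g ∧
        ∀ n m k : ℕ, f n m k ≤ MSOOrder.iterExp (g n m) k) ∧
    (∀ C : Set MSOOrder.FinGraph.{u}, MSOOrder.MSO2Orderable C →
      ∃ f : ℕ → ℕ, MSOOrder.IsElementary f ∧ MSOOrder.HasSEP C f) := by
  refine ⟨⟨fun n m k => MSOOrder.iterExp (2 * n + 3 * m + 10) k,
    fun n m k G φ hφ hO => MSOOrder.sep_le_iterExp k G hφ hO,
    _, MSOOrder.computable_linear, fun n m k => le_rfl⟩, ?_⟩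
  rintro C ⟨n, φ, hC⟩
  refine ⟨MSOOrder.iterExp (2 * n + 3 * φ.qr + 10), ⟨_, fun k => le_rfl⟩, fun G hG k => ?_⟩
  refine MSOOrder.sep_le_iterExp k G le_rfl ?_
  -- Orderability of a class says nothing about the empty graph, but there any formula defines a
  -- linear order.
  rcases isEmpty_or_nonempty (MSOOrder.Incidence G.graph) with h | h
  · exact ⟨fun _ => ∅, {
      refl := isEmptyElim
      trans := isEmptyElim
      antisymm := isEmptyElim
      total := isEmptyElim }⟩
  · exact hC G hG h
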